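/- For a finite abelian group $G$, written additively, let $\exp(G)$ be its exponent and let its rank be the minimal number of generators of $G$ (equivalently, the number $r$ in $G\cong\mathbb Z_{n_1}\oplus\cdots\oplus\mathbb Z_{n_r}$ with $1<n_1\mid n_2\mid\cdots\mid n_r$). Let $\mathsf s_{\{\pm1\}}(G)$ be the least integer $n$ such that every finite sequence $c_1,\dots,c_l$ of elements of $G$ of length $l\ge n$ has a subsequence $c_{i_1},\dots,c_{i_k}$ ($i_1<\cdots<i_k$) of length $k=\exp(G)$ for which there are signs $a_1,\dots,a_k\in\{1,-1\}$ with $\sum_{j=1}^k a_jc_{i_j}=0$. Theorem 1.2. Let $r\ge 1$ be an integer. (1) There is a constant $C_r$, depending only on $r$, such that every finite abelian group $G$ of rank $r$ and even exponent satisfies $$\mathsf s_{\{\pm1\}}(G)\le \exp(G)+\log_2|G|+C_r\log_2\log_2|G|.$$ (2) Moreover, for finite abelian groups $G$ of rank $r$ and even exponent, $$\mathsf s_{\{\pm1\}}(G)=\exp(G)+\log_2|G|+O_r(\log_2\log_2|G|)\quad\text{as }\exp(G)\to\infty,$$ that is, there are a constant $C'_r>0$ and an integer $N_r$, depending only on $r$,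 such that $\bigl|\mathsf s_{\{\pm1\}}(G)-\exp(G)-\log_2|G|\bigr|\le C'_r\,\bigl|\log_2\log_2|G|\bigr|$ for every such $G$ with $\exp(G)\ge N_r$. -/

import Mathlib

universe u

/-- The subsequence of `c` indexed by `I` has `0` as an `A`-weighted sum: there are weights
`a i ∈ A`, for `i ∈ I`, with `∑ i ∈ I, a i • c i = 0`. -/
def IsWeightedZeroSum {G : Type u} [AddCommGroup G] (A : Set ℤ) {l : ℕ} (c : Fin l → G)
    (I : Finset (Fin l)) : Prop :=
  ∃ a : Fin l → ℤ, (∀ i ∈ I, a i ∈ A) ∧ ∑ i ∈ I, a i • c i = 0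

/-- The set of all `n` such that every finite sequence over `G` of length at least `n` has an
`A`-weighted zero-sum subsequence of length `exp(G)`. -/
def weightedEGZSet (A : Set ℤ) (G : Type u) [AddCommGroup G] : Set ℕ :=
  {n | ∀ l : ℕ, n ≤ l → ∀ c : Fin l → G,
    ∃ I : Finset (Fin l), I.card = AddMonoid.exponent G ∧ IsWeightedZeroSum A c I}

/-- The constant `s_A(G)`: the least `n` such that every finite sequence over `G` of length at
least `n` has an `A`-weighted zero-sum subsequence of length `exp(G)`. For finite `G` and
`A = {1, -1}` such an `n` exists, see `weightedEGZSet_nonempty`. -/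
noncomputable def weightedEGZ (A : Set ℤ) (G : Type u) [AddCommGroup G] : ℕ :=
  sInf (weightedEGZSet A G)

theorem weightedEGZSet_nonempty (A : Set ℤ) (hA : 1 ∈ A) (G : Type u) [AddCommGroup G]
    [Finite G] : (weightedEGZSet A G).Nonempty := by
  classical
  have := Fintype.ofFinite G
  refine ⟨Fintype.card G * AddMonoid.exponent G, fun l hl c => ?_⟩
  obtain ⟨g, -, hg⟩ := Finset.exists_le_card_fiber_of_mul_le_card_of_maps_to
    (s := (Finset.univ : Finset (Fin l))) (t := (Finset.univ : Finset G)) (f := c)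
    (n := AddMonoid.exponent G) (fun _ _ => Finset.mem_univ _) Finset.univ_nonempty
    (by simpa using hl)
  obtain ⟨I, hI, hcard⟩ := Finset.exists_subset_card_eq hg
  refine ⟨I, hcard, fun _ => 1, fun _ _ => hA, ?_⟩
  have h : ∀ i ∈ I, (1 : ℤ) • c i = g := fun i hi => by
    simpa using (Finset.mem_filter.1 (hI hi)).2
  rw [Finset.sum_congr rfl h, Finset.sum_const, hcard, AddMonoid.exponent_nsmul_eq_zero]

/-! Two index sets with equal sums give a signed zero-sum on their symmetric difference, so
pigeonhole on subset sums produces signed zero-sums; the difficulty is controlling their lengths.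
Put `n = exp(G)`, so that `|G| ≤ n ^ r`.

Upper bound. Fix an odd prime `p`. Among `L ≈ log₂|G| + O(log₂ log₂|G|)` terms, more than `(L + 1) ^
(p - 1)` subsets share both sum and parity of size; a polynomial argument mod `p` then finds two
whose symmetric difference has size divisible by `2 * p`
(`exists_isWeightedZeroSum_two_mul_dvd_card`). Joining such pieces greedily gives a signed zero-sum
of length within `2 * p * L` of `n`. The gap is closed by a reservoir of `L` disjoint signed
zero-sums of length exactly `2 * p`, once the length is congruent to `n` mod `2 * p`.

Exact short lengths come from an energy estimate (`exists_isWeightedZeroSum_card_eq_two_mul`): a set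
of order `|G| ^ (1 / (r + 1))` indices realises at least one of any `r + 1` prescribed bounded even
lengths. This is applied to `r + 1` candidate primes for the reservoir, and to `r + 1` lengths
congruent to 2 mod `2 * p` for the residue.

Lower bound. Adjoining generators one by one, the terms `2 ^ j • g` form a sequence of length at
least `log₂|G| - r` without signed zero-sums; it is padded with `n - 1` zeros. -/

/-! ### Signed zero-sums and symmetric differences -/

theorem IsWeightedZeroSum.empty {G : Type u} [AddCommGroup G] (A : Set ℤ) {l : ℕ}
    (c : Fin l → G) : IsWeightedZeroSum A c ∅ :=
  ⟨0, by simp, by simp⟩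

theorem IsWeightedZeroSum.union {G : Type u} [AddCommGroup G] {A : Set ℤ} {l : ℕ}
    {c : Fin l → G} {I J : Finset (Fin l)} (hI : IsWeightedZeroSum A c I)
    (hJ : IsWeightedZeroSum A c J) (h : Disjoint I J) : IsWeightedZeroSum A c (I ∪ J) := by
  classical
  obtain ⟨a, ha, ha0⟩ := hI
  obtain ⟨b, hb, hb0⟩ := hJ
  have hJI : ∀ i ∈ J, i ∉ I := fun i hi hi' => Finset.disjoint_left.1 h hi' hi
  refine ⟨fun i => if i ∈ I then a i else b i, fun i hi => ?_, ?_⟩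
  · by_cases hiI : i ∈ I
    · simpa [hiI] using ha i hiI
    · simpa [hiI] using hb i ((Finset.mem_union.1 hi).resolve_left hiI)
  · rw [Finset.sum_union h, ← add_zero (0 : G), ← ha0]
    congr 1
    · exact Finset.sum_congr rfl fun i hi => by simp [hi]
    · rw [ha0, ← hb0]
      exact Finset.sum_congr rfl fun i hi => by simp [hJI i hi]

theorem IsWeightedZeroSum.biUnion {G : Type u} [AddCommGroup G] {A : Set ℤ} {l : ℕ}
    {c : Fin l → G} (S : Finset (Finset (Fin l))) (hS : ∀ I ∈ S, IsWeightedZeroSum A c I)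
    (hd : (S : Set (Finset (Fin l))).PairwiseDisjoint id) :
    IsWeightedZeroSum A c (S.biUnion id) := by
  classical
  induction S using Finset.induction_on with
  | empty => simpa using IsWeightedZeroSum.empty A c
  | insert I S hIS ih =>
    rw [Finset.biUnion_insert]
    refine (hS I (by simp)).union (ih (fun J hJ => hS J (by simp [hJ]))
      (hd.subset (by simp))) ?_
    rw [Finset.disjoint_biUnion_right]
    exact fun J hJ => hd (by simp) (by simp [hJ]) (by rintro rfl; exact hIS hJ)

/-- Subtracting one sum from the other cancels the common indices and leaves signs `1` on `I \ J`
and `-1` on `J \ I`. -/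
theorem isWeightedZeroSum_symmDiff {G : Type u} [AddCommGroup G] {l : ℕ} {c : Fin l → G}
    {I J : Finset (Fin l)} (h : ∑ i ∈ I, c i = ∑ i ∈ J, c i) :
    IsWeightedZeroSum {1, -1} c (symmDiff I J) := by
  classical
  refine ⟨fun i => if i ∈ I then 1 else -1, fun i _ => by by_cases hi : i ∈ I <;> simp [hi], ?_⟩
  rw [symmDiff_def, Finset.sup_eq_union, Finset.sum_union disjoint_sdiff_sdiff]
  have h1 : ∑ i ∈ I \ J, (if i ∈ I then 1 else -1 : ℤ) • c i = ∑ i ∈ I \ J, c i :=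
    Finset.sum_congr rfl fun i hi => by simp [(Finset.mem_sdiff.1 hi).1]
  have h2 : ∑ i ∈ J \ I, (if i ∈ I then 1 else -1 : ℤ) • c i = - ∑ i ∈ J \ I, c i := by
    rw [← Finset.sum_neg_distrib]
    exact Finset.sum_congr rfl fun i hi => by simp [(Finset.mem_sdiff.1 hi).2]
  rw [h1, h2, ← sub_eq_add_neg, sub_eq_zero]
  have h3 := Finset.sum_inter_add_sum_sdiff I J c
  have h4 := Finset.sum_inter_add_sum_sdiff J I c
  rw [Finset.inter_comm, ← h, ← h3] at h4
  exact (add_left_cancel h4).symm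

/-! ### Polynomial method: symmetric differences of size divisible by `p` -/

/-- For fixed `A` the size is an affine function of the indicator vector of `B`, so its `(p - 1)`-th
power has degree at most `p - 1`. -/
theorem card_symmDiff_cast {ι R : Type*} [DecidableEq ι] [CommRing R] {X A B : Finset ι}
    (hB : B ⊆ X) :
    ((symmDiff A B).card : R) =
      A.card + ∑ x ∈ X, (1 - 2 * if x ∈ A then 1 else 0) * (if x ∈ B then (1 : R) else 0) := by
  have h0 : ∑ x ∈ X, (1 - 2 * if x ∈ A then 1 else 0) * (if x ∈ B then (1 : R) else 0) =
      B.card - 2 * (A ∩ B).card := by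
    have : ∀ x ∈ X, (1 - 2 * if x ∈ A then 1 else 0) * (if x ∈ B then (1 : R) else 0) =
      (if x ∈ B then (1 : R) else 0) - 2 * (if x ∈ A ∩ B then 1 else 0) := by
      intro x _
      by_cases h1 : x ∈ A <;> by_cases h2 : x ∈ B <;> simp [h1, h2]
    rw [Finset.sum_congr rfl this, Finset.sum_sub_distrib, ← Finset.mul_sum, Finset.sum_boole,
      Finset.sum_boole, Finset.filter_mem_eq_inter, Finset.filter_mem_eq_inter,
      Finset.inter_eq_right.2 hB,
      Finset.inter_eq_right.2 (Finset.inter_subset_right.trans hB)]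
  have h1 : (symmDiff A B).card + 2 * (A ∩ B).card = A.card + B.card := by
    rw [symmDiff_def, Finset.sup_eq_union, Finset.card_union_of_disjoint disjoint_sdiff_sdiff]
    have := Finset.card_sdiff_add_card_inter A B
    have h' := Finset.card_sdiff_add_card_inter B A
    rw [Finset.inter_comm B A] at h'
    omega
  have h2 := congrArg (Nat.cast : ℕ → R) h1
  push_cast at h2
  rw [h0]
  linear_combination h2

/-- A family of subsets of `X` in which no symmetric difference of two distinct members has size
divisible by the prime `p` is polynomially small. -/
theorem card_le_of_forall_not_dvd_card_symmDiff {ι : Type*} [DecidableEq ι] {p : ℕ}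
    (hp : p.Prime) (X : Finset ι) (F : Finset (Finset ι)) (hF : ∀ A ∈ F, A ⊆ X)
    (h : ∀ A ∈ F, ∀ B ∈ F, A ≠ B → ¬ p ∣ (symmDiff A B).card) :
    F.card ≤ (X.card + 1) ^ (p - 1) := by
  classical
  have : Fact p.Prime := ⟨hp⟩
  -- `none` stands for the constant 1, so the products `M t` include every monomial of degree at
  -- most `p - 1` in the indicator of `B`.
  let m : Option X → F → ZMod p := fun o B => o.elim 1 fun x => if x.1 ∈ B.1 then 1 else 0
  let M : (Fin (p - 1) → Option X) → F → ZMod p := fun t B => ∏ i, m (t i) B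
  have hspan : Submodule.span (ZMod p) (Set.range M) = ⊤ := by
    rw [eq_top_iff, ← (Pi.basisFun (ZMod p) F).span_eq, Submodule.span_le]
    rintro _ ⟨A, rfl⟩
    let co : Option X → ZMod p := fun o =>
      o.elim (A.1.card : ZMod p) fun x => 1 - 2 * if x.1 ∈ A.1 then 1 else 0
    have hd : ∀ B : F, ((symmDiff A.1 B.1).card : ZMod p) = ∑ o, co o * m o B := by
      intro B
      rw [card_symmDiff_cast (hF B.1 B.2), Fintype.sum_option, ← Finset.sum_coe_sort X]
      simp [co, m]
    have hpow : ∀ B : F, ((symmDiff A.1 B.1).card : ZMod p) ^ (p - 1) =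
        ∑ t : Fin (p - 1) → Option X, (∏ i, co (t i)) * M t B := by
      intro B
      rw [hd, Fintype.sum_pow]
      simp [M, Finset.prod_mul_distrib]
    have hone : M (fun _ => none) = 1 := by ext; simp [M, m]
    -- By Fermat, `1 - |A ∆ B| ^ (p - 1)` is 1 at `B = A` and 0 at every other member of `F`. Hence
    -- the `M t` span all functions on `F`, which bounds `F.card` by their number.
    have heq : Pi.basisFun (ZMod p) F A =
        M (fun _ => none) - ∑ t : Fin (p - 1) → Option X, (∏ i, co (t i)) • M t := by
      ext B
      rw [hone]
      simp only [Pi.basisFun_apply, Pi.sub_apply, Pi.one_apply, Finset.sum_apply, Pi.smul_apply,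
        smul_eq_mul, ← hpow]
      by_cases hAB : A = B
      · subst hAB
        simp [Nat.sub_ne_zero_of_lt hp.one_lt]
      · rw [Pi.single_eq_of_ne (Ne.symm hAB), ZMod.pow_card_sub_one_eq_one, sub_self]
        rw [Ne, ZMod.natCast_eq_zero_iff]
        exact h A.1 A.2 B.1 B.2 fun h => hAB (Subtype.ext h)
    rw [SetLike.mem_coe, heq]
    exact Submodule.sub_mem _ (Submodule.subset_span ⟨_, rfl⟩) (Submodule.sum_mem _ fun t _ =>
      Submodule.smul_mem _ _ (Submodule.subset_span ⟨t, rfl⟩))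
  have h1 := finrank_range_le_card (R := ZMod p) M
  rw [Set.finrank, hspan, finrank_top] at h1
  simpa using h1

/-- A long sequence has a nonempty signed zero-sum subsequence with length divisible by `2 * p`. -/
theorem exists_isWeightedZeroSum_two_mul_dvd_card {G : Type u} [AddCommGroup G] [Finite G] {l : ℕ}
    (c : Fin l → G) {p : ℕ} (hp : p.Prime) (hp2 : p ≠ 2) (X : Finset (Fin l))
    (hX : 2 * Nat.card G * (X.card + 1) ^ (p - 1) < 2 ^ X.card) :
    ∃ I ⊆ X, I.Nonempty ∧ 2 * p ∣ I.card ∧ IsWeightedZeroSum {1, -1} c I := by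
  classical
  have := Fintype.ofFinite G
  -- The `ZMod 2` coordinate fixes the parity of the size, which makes symmetric differences even.
  obtain ⟨⟨g, e⟩, -, hge⟩ := Finset.exists_lt_card_fiber_of_mul_lt_card_of_maps_to
    (s := X.powerset) (t := (Finset.univ : Finset (G × ZMod 2)))
    (f := fun A => (∑ i ∈ A, c i, (A.card : ZMod 2))) (n := (X.card + 1) ^ (p - 1))
    (fun _ _ => Finset.mem_univ _) (by
      rw [Finset.card_powerset, Finset.card_univ, Fintype.card_prod, ZMod.card,
        ← Nat.card_eq_fintype_card, mul_comm (Nat.card G)]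
      exact hX)
  by_contra! hcon
  refine hge.not_ge (card_le_of_forall_not_dvd_card_symmDiff hp X _ ?_ ?_)
  · intro A hA
    exact Finset.mem_powerset.1 (Finset.mem_filter.1 hA).1
  · intro A hA B hB hAB hdvd
    simp only [Finset.mem_filter, Finset.mem_powerset, Prod.mk.injEq] at hA hB
    refine hcon (symmDiff A B) ?_ ?_ ?_ (isWeightedZeroSum_symmDiff (hA.2.1.trans hB.2.1.symm))
    · exact symmDiff_le_sup.trans (Finset.union_subset hA.1 hB.1)
    · rw [Finset.nonempty_iff_ne_empty, Ne, ← Finset.bot_eq_empty, symmDiff_eq_bot]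
      exact hAB
    · refine Nat.Coprime.mul_dvd_of_dvd_of_dvd
        ((Nat.coprime_primes Nat.prime_two hp).2 hp2.symm) ?_ hdvd
      rw [← ZMod.natCast_eq_zero_iff, card_symmDiff_cast hB.1]
      have h2 : (2 : ZMod 2) = 0 := rfl
      simp only [h2, zero_mul, sub_zero, one_mul, Finset.sum_boole, Finset.filter_mem_eq_inter,
        Finset.inter_eq_right.2 hB.1, hA.2.2, hB.2.2, ← two_mul]

/-! ### Energy of subset sums and signed zero-sums of exact length -/

/-- The number of `k`-element subsets of `X` over which `c` sums to `g`. -/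
noncomputable def subsetSumCount {G : Type u} [AddCommGroup G] {l : ℕ} (c : Fin l → G)
    (X : Finset (Fin l)) (k : ℕ) (g : G) : ℕ :=
  open Classical in ((X.powersetCard k).filter fun A => ∑ i ∈ A, c i = g).card

theorem card_filter_mem_le_subsetSumCount {G : Type u} [AddCommGroup G] {l : ℕ} (c : Fin l → G)
    (X : Finset (Fin l)) (k : ℕ) (g : G) (x : Fin l) :
    open Classical in (((X.powersetCard (k + 1)).filter fun A => ∑ i ∈ A, c i = g).filter
      fun A => x ∈ A).card ≤ subsetSumCount c X k (g - c x) := by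
  classical
  rw [subsetSumCount]
  refine Finset.card_le_card_of_injOn (fun A => A.erase x) ?_ ?_
  · intro A hA
    simp only [Finset.coe_filter, Finset.mem_filter, Finset.mem_powersetCard,
      Set.mem_ofPred_eq] at hA ⊢
    obtain ⟨⟨⟨hAX, hAk⟩, hAg⟩, hxA⟩ := hA
    refine ⟨⟨(Finset.erase_subset _ _).trans hAX, ?_⟩, ?_⟩
    · rw [Finset.card_erase_of_mem hxA, hAk, Nat.add_sub_cancel]
    · rw [← hAg, ← Finset.add_sum_erase A c hxA, add_sub_cancel_left]
  · intro A hA B hB h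
    simp only [Finset.coe_filter, Finset.mem_filter, Set.mem_ofPred_eq] at hA hB
    rw [← Finset.insert_erase hA.2, ← Finset.insert_erase hB.2]
    exact congrArg _ h

theorem subsetSumCount_succ_le {G : Type u} [AddCommGroup G] {l : ℕ} (c : Fin l → G)
    (X : Finset (Fin l)) (k : ℕ) (g : G) :
    subsetSumCount c X (k + 1) g ≤ ∑ x ∈ X, subsetSumCount c X k (g - c x) := by
  classical
  refine le_trans ?_ (Finset.sum_le_sum fun x _ => card_filter_mem_le_subsetSumCount c X k g x)
  rw [subsetSumCount]
  refine (Finset.card_le_card fun A hA => ?_).trans Finset.card_biUnion_le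
  have hA' := Finset.mem_powersetCard.1 (Finset.mem_filter.1 hA).1
  obtain ⟨x, hx⟩ : A.Nonempty := Finset.card_pos.1 (by omega)
  exact Finset.mem_biUnion.2 ⟨x, hA'.1 hx, Finset.mem_filter.2 ⟨hA, hx⟩⟩

/-- Disjoint sets with equal sums would form a forbidden signed zero-sum, so the sets counted on the
left pairwise intersect. Each pair is counted through a common element, which avoids the factor
`X.card` lost to Cauchy–Schwarz. -/
theorem subsetSumCount_succ_sq_le {G : Type u} [AddCommGroup G] {l : ℕ} (c : Fin l → G)
    (X : Finset (Fin l)) (k : ℕ) (g : G)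
    (h : ∀ I ⊆ X, I.card = 2 * (k + 1) → ¬ IsWeightedZeroSum {1, -1} c I) :
    subsetSumCount c X (k + 1) g ^ 2 ≤ ∑ x ∈ X, subsetSumCount c X k (g - c x) ^ 2 := by
  classical
  refine le_trans ?_ (Finset.sum_le_sum fun x _ =>
    Nat.pow_le_pow_left (card_filter_mem_le_subsetSumCount c X k g x) 2)
  rw [subsetSumCount, sq, ← Finset.card_product]
  simp_rw [sq, ← Finset.card_product]
  refine (Finset.card_le_card fun A hA => ?_).trans Finset.card_biUnion_le
  obtain ⟨A, B⟩ := A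
  simp only [Finset.mem_product] at hA
  have hA' := Finset.mem_filter.1 hA.1
  have hB' := Finset.mem_filter.1 hA.2
  rw [Finset.mem_powersetCard] at hA' hB'
  have hAB : ¬ Disjoint A B := by
    intro hd
    refine h (symmDiff A B) (symmDiff_le_sup.trans (Finset.union_subset hA'.1.1 hB'.1.1)) ?_
      (isWeightedZeroSum_symmDiff (hA'.2.trans hB'.2.symm))
    rw [hd.symmDiff_eq_sup, Finset.sup_eq_union, Finset.card_union_of_disjoint hd, hA'.1.2,
      hB'.1.2, two_mul]
  obtain ⟨x, hxA, hxB⟩ := Finset.not_disjoint_iff.1 hAB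
  exact Finset.mem_biUnion.2 ⟨x, hA'.1.1 hxA, Finset.mem_product.2
    ⟨Finset.mem_filter.2 ⟨hA.1, hxA⟩, Finset.mem_filter.2 ⟨hA.2, hxB⟩⟩⟩

/-- The number of pairs of `k`-element subsets of `X` over which `c` has the same sum. -/
noncomputable def subsetSumEnergy {G : Type u} [AddCommGroup G] [Fintype G] {l : ℕ}
    (c : Fin l → G) (X : Finset (Fin l)) (k : ℕ) : ℕ :=
  ∑ g, subsetSumCount c X k g ^ 2

theorem sum_sum_subsetSumCount_sub_sq {G : Type u} [AddCommGroup G] [Fintype G] {l : ℕ}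
    (c : Fin l → G) (X : Finset (Fin l)) (k : ℕ) :
    ∑ g, ∑ x ∈ X, subsetSumCount c X k (g - c x) ^ 2 = X.card * subsetSumEnergy c X k := by
  rw [Finset.sum_comm, ← smul_eq_mul, ← Finset.sum_const]
  exact Finset.sum_congr rfl fun x _ =>
    (Equiv.subRight (c x)).sum_comp fun g => subsetSumCount c X k g ^ 2

theorem subsetSumEnergy_succ_le {G : Type u} [AddCommGroup G] [Fintype G] {l : ℕ}
    (c : Fin l → G) (X : Finset (Fin l)) (k : ℕ) :
    subsetSumEnergy c X (k + 1) ≤ X.card ^ 2 * subsetSumEnergy c X k := by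
  rw [sq, mul_assoc, ← sum_sum_subsetSumCount_sub_sq, Finset.mul_sum]
  exact Finset.sum_le_sum fun g _ =>
    (Nat.pow_le_pow_left (subsetSumCount_succ_le c X k g) 2).trans sq_sum_le_card_mul_sum_sq

theorem subsetSumEnergy_succ_le_of_forall_not {G : Type u} [AddCommGroup G] [Fintype G] {l : ℕ}
    (c : Fin l → G) (X : Finset (Fin l)) (k : ℕ)
    (h : ∀ I ⊆ X, I.card = 2 * (k + 1) → ¬ IsWeightedZeroSum {1, -1} c I) :
    subsetSumEnergy c X (k + 1) ≤ X.card * subsetSumEnergy c X k := by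
  rw [← sum_sum_subsetSumCount_sub_sq]
  exact Finset.sum_le_sum fun g _ => subsetSumCount_succ_sq_le c X k g h

/-- Each step in `k` multiplies the energy by at most `X.card ^ 2`, and by only `X.card` when the
new size lies in `J`. -/
theorem subsetSumEnergy_mul_pow_le {G : Type u} [AddCommGroup G] [Fintype G] {l : ℕ}
    (c : Fin l → G) (X : Finset (Fin l)) (J : Finset ℕ)
    (h : ∀ k ∈ J, ∀ I ⊆ X, I.card = 2 * k → ¬ IsWeightedZeroSum {1, -1} c I) (k : ℕ) :
    subsetSumEnergy c X k * X.card ^ (J ∩ Finset.Icc 1 k).card ≤ X.card ^ (2 * k) := by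
  classical
  induction k with
  | zero =>
    have : ∀ g, subsetSumCount c X 0 g = if 0 = g then 1 else 0 := by
      intro g
      rw [subsetSumCount, Finset.powersetCard_zero]
      by_cases hg : 0 = g
      · rw [Finset.filter_true_of_mem (by simpa using hg), if_pos hg, Finset.card_singleton]
      · rw [Finset.filter_false_of_mem (by simpa using hg), if_neg hg, Finset.card_empty]
    simp [subsetSumEnergy, this]
  | succ k ih =>
    rw [← Finset.insert_Icc_right_eq_Icc_add_one (by omega)]
    by_cases hk : k + 1 ∈ J
    · rw [Finset.inter_insert_of_mem hk, Finset.card_insert_of_notMem (by simp)]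
      calc _ ≤ (X.card * subsetSumEnergy c X k) *
            X.card ^ ((J ∩ Finset.Icc 1 k).card + 1) := by
              gcongr
              exact subsetSumEnergy_succ_le_of_forall_not c X k (h _ hk)
        _ = X.card ^ 2 * (subsetSumEnergy c X k * X.card ^ (J ∩ Finset.Icc 1 k).card) := by ring
        _ ≤ X.card ^ 2 * X.card ^ (2 * k) := by gcongr
        _ = _ := by ring
    · rw [Finset.inter_insert_of_notMem hk]
      calc _ ≤ (X.card ^ 2 * subsetSumEnergy c X k) * X.card ^ (J ∩ Finset.Icc 1 k).card := by
              gcongr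
              exact subsetSumEnergy_succ_le c X k
        _ = X.card ^ 2 * (subsetSumEnergy c X k * X.card ^ (J ∩ Finset.Icc 1 k).card) := by ring
        _ ≤ X.card ^ 2 * X.card ^ (2 * k) := by gcongr
        _ = _ := by ring

theorem choose_sq_le_card_mul_subsetSumEnergy {G : Type u} [AddCommGroup G] [Fintype G] {l : ℕ}
    (c : Fin l → G) (X : Finset (Fin l)) (k : ℕ) :
    X.card.choose k ^ 2 ≤ Fintype.card G * subsetSumEnergy c X k := by
  classical
  have h : X.card.choose k = ∑ g, subsetSumCount c X k g := by
    rw [← Finset.card_powersetCard]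
    simp only [subsetSumCount]
    rw [Finset.card_eq_sum_card_fiberwise (f := fun A => ∑ i ∈ A, c i) (t := Finset.univ)
      (fun _ _ => by simp)]
  rw [h, subsetSumEnergy, ← Finset.card_univ]
  exact sq_sum_le_card_mul_sum_sq

theorem pow_le_mul_choose {n k : ℕ} (h : 2 * k ≤ n) :
    n ^ k ≤ 2 ^ k * k.factorial * n.choose k := by
  rw [mul_assoc, ← Nat.descFactorial_eq_factorial_mul_choose]
  calc n ^ k ≤ (2 * (n + 1 - k)) ^ k := Nat.pow_le_pow_left (by omega) k
    _ = 2 ^ k * (n + 1 - k) ^ k := mul_pow _ _ _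
    _ ≤ _ := by
      gcongr
      exact Nat.pow_sub_le_descFactorial n k

/-- If `X` is large in terms of `G`, then for at least one `k` in any set `J` of more than `r`
bounded numbers there is a signed zero-sum subsequence of length exactly `2 * k`. -/
theorem exists_isWeightedZeroSum_card_eq_two_mul {G : Type u} [AddCommGroup G] [Finite G] {l : ℕ}
    (c : Fin l → G) (X : Finset (Fin l)) (J : Finset ℕ) {K : ℕ} (hJ : J ⊆ Finset.Icc 1 K)
    (hK : 2 * K ≤ X.card)
    (hX : (2 ^ K * K.factorial) ^ 2 * Nat.card G < X.card ^ J.card) :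
    ∃ k ∈ J, ∃ I ⊆ X, I.card = 2 * k ∧ IsWeightedZeroSum {1, -1} c I := by
  classical
  have := Fintype.ofFinite G
  by_contra! hcon
  -- The energy is at most `|X| ^ (2K - |J|)`, but by Cauchy–Schwarz at least `(|X| choose K) ^ 2 /
  -- |G|`, of order `|X| ^ (2K) / |G|`. Together these contradict `hX`.
  have h1 := subsetSumEnergy_mul_pow_le c X J hcon K
  rw [Finset.inter_eq_left.2 hJ] at h1
  have h2 := choose_sq_le_card_mul_subsetSumEnergy c X K
  have h3 := Nat.pow_le_pow_left (pow_le_mul_choose hK) 2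
  rw [← Nat.card_eq_fintype_card] at h2
  have hXpos : 0 < X.card ^ (2 * K) := by
    rcases Nat.eq_zero_or_pos X.card with h0 | h0
    · have : K = 0 := by omega
      simp [this]
    · positivity
  have : X.card ^ (2 * K) * X.card ^ J.card ≤
      X.card ^ (2 * K) * ((2 ^ K * K.factorial) ^ 2 * Nat.card G) := by
    calc X.card ^ (2 * K) * X.card ^ J.card = (X.card ^ K) ^ 2 * X.card ^ J.card := by ring
      _ ≤ (2 ^ K * K.factorial * X.card.choose K) ^ 2 * X.card ^ J.card := by gcongr
      _ = (2 ^ K * K.factorial) ^ 2 * (X.card.choose K ^ 2) * X.card ^ J.card := by ring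
      _ ≤ (2 ^ K * K.factorial) ^ 2 * (Nat.card G * subsetSumEnergy c X K) * X.card ^ J.card := by
        gcongr
      _ = (2 ^ K * K.factorial) ^ 2 * Nat.card G *
          (subsetSumEnergy c X K * X.card ^ J.card) := by ring
      _ ≤ (2 ^ K * K.factorial) ^ 2 * Nat.card G * X.card ^ (2 * K) := by gcongr
      _ = _ := by ring
  exact absurd (Nat.le_of_mul_le_mul_left this hXpos) (by omega)

/-! ### Packing disjoint pieces and reaching length exactly `n` -/

/-- Greedy choice: the sets already chosen cover at most `m * b` points, so at least `h` points
remain. -/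
theorem exists_pairwiseDisjoint_of_forall_card_le {ι : Type*} {P : Finset ι → Prop} {h b : ℕ}
    {X : Finset ι}
    (hP : ∀ Y ⊆ X, h ≤ Y.card → ∃ I ⊆ Y, I.Nonempty ∧ I.card ≤ b ∧ P I) {m : ℕ}
    (hX : h + m * b ≤ X.card) :
    ∃ S : Finset (Finset ι), S.card = m ∧ (S : Set (Finset ι)).PairwiseDisjoint id ∧
      ∀ I ∈ S, I ⊆ X ∧ I.card ≤ b ∧ P I := by
  classical
  induction m with
  | zero => exact ⟨∅, by simp⟩
  | succ m ih =>
    rw [add_one_mul] at hX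
    obtain ⟨S, hSm, hSd, hS⟩ := ih (by omega)
    have hU : (S.biUnion id).card ≤ m * b :=
      hSm ▸ Finset.card_biUnion_le_card_mul S id b fun I hI => (hS I hI).2.1
    have hY := Finset.le_card_sdiff (S.biUnion id) X
    obtain ⟨I, hIY, hIne, hIb, hPI⟩ := hP (X \ S.biUnion id) Finset.sdiff_subset (by omega)
    have hdisj : ∀ J ∈ S, Disjoint I J := fun J hJ =>
      Finset.disjoint_of_subset_right (Finset.subset_biUnion_of_mem id hJ)
        (Finset.disjoint_of_subset_left hIY Finset.sdiff_disjoint)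
    have hIS : I ∉ S := fun hI => hIne.ne_empty (disjoint_self.1 (hdisj I hI))
    refine ⟨insert I S, by rw [Finset.card_insert_of_notMem hIS, hSm], ?_, ?_⟩
    · rw [Finset.coe_insert]
      exact hSd.insert fun J hJ _ => hdisj J hJ
    · intro J hJ
      rcases Finset.mem_insert.1 hJ with rfl | hJ
      · exact ⟨hIY.trans Finset.sdiff_subset, hIb, hPI⟩
      · exact hS J hJ

theorem card_biUnion_id_eq_mul {ι : Type*} [DecidableEq ι] {S : Finset (Finset ι)} {k : ℕ}
    (hd : (S : Set (Finset ι)).PairwiseDisjoint id) (hk : ∀ I ∈ S, I.card = k) :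
    (S.biUnion id).card = S.card * k := by
  rw [Finset.card_biUnion hd]
  exact Finset.sum_const_nat hk

/-- A reservoir of disjoint signed zero-sums of equal length `2 * p` completes a signed zero-sum
of maximal length in its residue class modulo `2 * p` to one of length exactly `n`. -/
theorem exists_isWeightedZeroSum_card_eq_of_reservoir {G : Type u} [AddCommGroup G] [Finite G]
    {n L l p : ℕ} (hp : p.Prime) (hp2 : p ≠ 2)
    (hL : 2 * Nat.card G * (L + 1) ^ (p - 1) < 2 ^ L) (c : Fin l → G) (hl : n + L ≤ l)
    (S : Finset (Finset (Fin l))) (hSL : S.card = L)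
    (hSd : (S : Set (Finset (Fin l))).PairwiseDisjoint id)
    (hS : ∀ I ∈ S, I.card = 2 * p ∧ IsWeightedZeroSum {1, -1} c I)
    (T : Finset (Fin l)) (hTn : T.card ≤ n) (hTmod : T.card ≡ n [MOD 2 * p])
    (hT : IsWeightedZeroSum {1, -1} c T) (hTS : ∀ I ∈ S, Disjoint T I) :
    ∃ I : Finset (Fin l), I.card = n ∧ IsWeightedZeroSum {1, -1} c I := by
  classical
  have hR := card_biUnion_id_eq_mul hSd fun I hI => (hS I hI).1
  set R := S.biUnion id with hRdef
  obtain ⟨J, hJ, hJmax⟩ := Finset.exists_max_image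
    (Finset.univ.filter fun J : Finset (Fin l) => Disjoint J R ∧ J.card ≤ n ∧
      J.card ≡ n [MOD 2 * p] ∧ IsWeightedZeroSum {1, -1} c J) Finset.card
    ⟨T, by simpa [hRdef, Finset.disjoint_biUnion_right] using ⟨hTS, hTn, hTmod, hT⟩⟩
  simp only [Finset.mem_filter, Finset.mem_univ, true_and] at hJ hJmax
  obtain ⟨hJR, hJn, hJmod, hJ0⟩ := hJ
  have hJbig : n < J.card + L * (2 * p) := by
    by_contra! hle
    -- If the gap were at least `2 * p * L = R.card`, then `L` indices would lie outside `J ∪ R`.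
    -- They yield a piece of length at most `L`, which still fits below `n` and contradicts
    -- maximality.
    have hc : L ≤ (Finset.univ \ (J ∪ R)).card := by
      have h1 := Finset.le_card_sdiff (J ∪ R) Finset.univ
      have h2 := Finset.card_union_le J R
      rw [Finset.card_univ, Fintype.card_fin] at h1
      rw [hR, hSL] at h2
      omega
    obtain ⟨Y, hY, hYL⟩ := Finset.exists_subset_card_eq hc
    obtain ⟨I, hIY, hIne, hIp, hI0⟩ :=
      exists_isWeightedZeroSum_two_mul_dvd_card c hp hp2 Y (by rwa [hYL])
    have hId : Disjoint I (J ∪ R) :=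
      Finset.disjoint_of_subset_left (hIY.trans hY) Finset.sdiff_disjoint
    rw [Finset.disjoint_union_right] at hId
    have hIL := Finset.card_le_card hIY
    have hcard := Finset.card_union_of_disjoint hId.1.symm
    have hIpos := hIne.card_pos
    have := hJmax (J ∪ I) ⟨Finset.disjoint_union_left.2 ⟨hJR, hId.2⟩, by
      have : L * 1 ≤ L * (2 * p) := Nat.mul_le_mul_left L (by have := hp.pos; omega)
      omega, by
      rw [hcard]
      exact (Nat.ModEq.add_left _ ((Nat.modEq_zero_iff_dvd).2 hIp)).trans (by simpa using hJmod),
      hJ0.union hI0 hId.1.symm⟩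
    omega
  -- The gap is a multiple `2 * p * q` with `q < L`, filled by `q` reservoir blocks.
  obtain ⟨q, hq⟩ := (Nat.modEq_iff_dvd' hJn).1 hJmod
  have hqL : q ≤ S.card := by
    have : 2 * p * q < 2 * p * L := by rw [mul_comm _ L]; omega
    exact hSL ▸ (Nat.lt_of_mul_lt_mul_left this).le
  obtain ⟨S', hS', hS'q⟩ := Finset.exists_subset_card_eq hqL
  have hS'd := hSd.subset (Finset.coe_subset.2 hS')
  have hJS' : Disjoint J (S'.biUnion id) :=
    Finset.disjoint_of_subset_right (Finset.biUnion_subset_biUnion_of_subset_left id hS') hJR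
  refine ⟨J ∪ S'.biUnion id, ?_, hJ0.union
    (IsWeightedZeroSum.biUnion S' (fun I hI => (hS I (hS' hI)).2) hS'd) hJS'⟩
  rw [Finset.card_union_of_disjoint hJS',
    card_biUnion_id_eq_mul hS'd fun I hI => (hS I (hS' hI)).1, hS'q, mul_comm, ← hq]
  omega

/-- The energy argument does not let the prime be prescribed, only found among `r + 1` candidates.
Hypothesis `hn'` leaves `H` free indices after removing the reservoir candidates and the pieces that
correct the residue. -/
theorem exists_isWeightedZeroSum_card_eq {G : Type u} [AddCommGroup G] [Finite G]
    {r K n L H l : ℕ} (Q : Finset ℕ) (hQ : Q.card = r + 1)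
    (hQp : ∀ p ∈ Q, p.Prime ∧ p ≠ 2 ∧ p ≤ K) (hH : 2 * (1 + (r + 1) * K) ≤ H)
    (hHG : (2 ^ (1 + (r + 1) * K) * (1 + (r + 1) * K).factorial) ^ 2 * Nat.card G < H ^ (r + 1))
    (hL : 2 * Nat.card G * (L + 1) ^ K < 2 ^ L) (hn : Even n)
    (hn' : H + (r + 1) * L * (2 * K) + K * (2 * (1 + (r + 1) * K)) ≤ n)
    (c : Fin l → G) (hl : n + L ≤ l) :
    ∃ I : Finset (Fin l), I.card = n ∧ IsWeightedZeroSum {1, -1} c I := by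
  classical
  have hKK : K ≤ 1 + (r + 1) * K := by nlinarith [Nat.zero_le (r * K)]
  set K' := 1 + (r + 1) * K with hK'
  have bulk : ∀ J ⊆ Finset.Icc 1 K', J.card = r + 1 → ∀ X : Finset (Fin l), H ≤ X.card →
      ∃ k ∈ J, ∃ I ⊆ X, I.card = 2 * k ∧ IsWeightedZeroSum {1, -1} c I := by
    intro J hJ hJr X hX
    refine exists_isWeightedZeroSum_card_eq_two_mul c X J hJ (hH.trans hX) ?_
    rw [hJr]
    exact hHG.trans_le (Nat.pow_le_pow_left hX _)
  have hcardl : (Finset.univ : Finset (Fin l)).card = l := by simp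
  obtain ⟨S, hSm, hSd, hS⟩ := exists_pairwiseDisjoint_of_forall_card_le
    (P := fun I => IsWeightedZeroSum {1, -1} c I ∧ ∃ p ∈ Q, I.card = 2 * p) (h := H) (b := 2 * K)
    (X := Finset.univ) (m := (r + 1) * L) (by
      intro Y _ hY
      obtain ⟨p, hpQ, I, hIY, hIp, hI0⟩ := bulk Q (fun p hp => Finset.mem_Icc.2
        ⟨(hQp p hp).1.one_le, (hQp p hp).2.2.trans hKK⟩) hQ Y hY
      have := hQp p hpQ
      have := this.1.pos
      exact ⟨I, hIY, Finset.card_pos.1 (by omega), by omega, hI0, p, hpQ, hIp⟩) (by omega)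
  -- Of `(r + 1) * L` disjoint blocks, some `L` share the same prime.
  obtain ⟨p, hpQ, hpL⟩ := Finset.exists_le_card_fiber_of_mul_le_card_of_maps_to
    (s := S) (t := Q) (f := fun I => I.card / 2) (n := L)
    (fun I hI => by
      obtain ⟨-, -, -, p, hp, hIp⟩ := hS I hI
      simpa [hIp] using hp) (Finset.card_pos.1 (by omega)) (by rw [hSm, hQ])
  obtain ⟨S₁, hS₁, hS₁L⟩ := Finset.exists_subset_card_eq hpL
  obtain ⟨hp, hp2, hpK⟩ := hQp p hpQ
  have hS₁' : ∀ I ∈ S₁, I.card = 2 * p ∧ IsWeightedZeroSum {1, -1} c I := by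
    intro I hI
    obtain ⟨hIS, hIp⟩ := Finset.mem_filter.1 (hS₁ hI)
    obtain ⟨-, -, h0, q, -, hq⟩ := hS I hIS
    exact ⟨by omega, h0⟩
  have hS₁d : (S₁ : Set (Finset (Fin l))).PairwiseDisjoint id :=
    hSd.subset fun I hI => (Finset.mem_filter.1 (hS₁ hI)).1
  have hR := card_biUnion_id_eq_mul hS₁d fun I hI => (hS₁' I hI).1
  rw [hS₁L] at hR
  set R := S₁.biUnion id with hRdef
  have hmp : n / 2 % p < p := Nat.mod_lt _ hp.pos
  have hbound : n / 2 % p * (2 * K') ≤ K * (2 * K') := Nat.mul_le_mul_right _ (by omega)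
  -- Each block has length congruent to 2 mod `2 * p`, so `n / 2 % p` of them have total length
  -- congruent to `n`, as `n` is even.
  obtain ⟨S₂, hS₂m, hS₂d, hS₂⟩ := exists_pairwiseDisjoint_of_forall_card_le
    (P := fun I => IsWeightedZeroSum {1, -1} c I ∧ ∃ k, I.card = 2 * (1 + k * p)) (h := H)
    (b := 2 * K') (X := Finset.univ \ R) (m := n / 2 % p) (by
      intro Y _ hY
      obtain ⟨k, hkJ, I, hIY, hIk, hI0⟩ := bulk
        ((Finset.range (r + 1)).image fun i => 1 + (i + 1) * p) (fun k hk => by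
          obtain ⟨i, hi, rfl⟩ := Finset.mem_image.1 hk
          rw [Finset.mem_range] at hi
          rw [Finset.mem_Icc]
          exact ⟨by omega, Nat.add_le_add_left (Nat.mul_le_mul (by omega) hpK) 1⟩) (by
          rw [Finset.card_image_of_injective, Finset.card_range]
          intro i j hij
          have := Nat.eq_of_mul_eq_mul_right hp.pos (Nat.add_left_cancel hij)
          omega) Y hY
      obtain ⟨i, hi, rfl⟩ := Finset.mem_image.1 hkJ
      rw [Finset.mem_range] at hi
      have : (i + 1) * p ≤ (r + 1) * K := Nat.mul_le_mul (by omega) hpK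
      exact ⟨I, hIY, Finset.card_pos.1 (by omega), by omega, hI0, i + 1, hIk⟩) (by
      have h1 := Finset.le_card_sdiff R Finset.univ
      rw [hcardl, hR] at h1
      have h2 : L * (2 * p) ≤ (r + 1) * L * (2 * K) :=
        Nat.mul_le_mul (by nlinarith [Nat.zero_le (r * L)]) (by omega)
      omega)
  refine exists_isWeightedZeroSum_card_eq_of_reservoir hp hp2 (lt_of_le_of_lt ?_ hL) c hl S₁ hS₁L
    hS₁d hS₁' (S₂.biUnion id) ?_ ?_
    (IsWeightedZeroSum.biUnion S₂ (fun I hI => (hS₂ I hI).2.2.1) hS₂d) ?_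
  · exact Nat.mul_le_mul_left _ (Nat.pow_le_pow_right (by omega) (by omega))
  · have := Finset.card_biUnion_le_card_mul S₂ id (2 * K') fun I hI => (hS₂ I hI).2.1
    rw [hS₂m] at this
    omega
  · rw [Finset.card_biUnion hS₂d]
    have h1 : ∑ I ∈ S₂, (id I).card ≡ ∑ I ∈ S₂, 2 [MOD 2 * p] := by
      refine Nat.ModEq.sum fun I hI => ?_
      obtain ⟨-, -, -, k, hk⟩ := hS₂ I hI
      rw [id, hk, mul_add, mul_left_comm]
      simp [Nat.ModEq]
    refine h1.trans ?_
    rw [Finset.sum_const, smul_eq_mul, hS₂m, mul_comm _ 2]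
    obtain ⟨k, rfl⟩ := hn
    rw [← two_mul, Nat.mul_div_cancel_left _ two_pos]
    exact (Nat.mod_modEq k p).mul_left' 2
  · intro I hI
    rw [Finset.disjoint_biUnion_left]
    intro J hJ
    exact Finset.disjoint_of_subset_right (Finset.subset_biUnion_of_mem id hI)
      (Finset.disjoint_of_subset_left (hS₂ J hJ).1 Finset.sdiff_disjoint)

/-! ### Lower bound: sequences without signed zero-sums -/

theorem abs_sum_mul_two_pow_lt {k : ℕ} (a : Fin k → ℤ) (ha : ∀ j, |a j| ≤ 1) :
    |∑ j, a j * 2 ^ (j : ℕ)| < 2 ^ k := by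
  induction k with
  | zero => simp
  | succ k ih =>
    rw [Fin.sum_univ_castSucc]
    have h1 := ih (fun j => a j.castSucc) fun j => ha _
    have h2 : |a (Fin.last k) * 2 ^ k| ≤ 2 ^ k := by
      rw [abs_mul, abs_of_nonneg (by positivity : (0 : ℤ) ≤ 2 ^ k)]
      exact mul_le_of_le_one_left (by positivity) (ha _)
    refine (abs_add_le _ _).trans_lt ?_
    simp only [Fin.val_castSucc, Fin.val_last, pow_succ]
    linarith

theorem eq_zero_of_sum_mul_two_pow_eq_zero {k : ℕ} (a : Fin k → ℤ) (ha : ∀ j, |a j| ≤ 1)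
    (h : ∑ j, a j * 2 ^ (j : ℕ) = 0) : a = 0 := by
  induction k with
  | zero => exact Subsingleton.elim _ _
  | succ k ih =>
    rw [Fin.sum_univ_castSucc] at h
    simp only [Fin.val_castSucc, Fin.val_last] at h
    have h1 := abs_sum_mul_two_pow_lt (fun j => a j.castSucc) fun j => ha _
    rw [eq_neg_of_add_eq_zero_left h, abs_neg, abs_mul,
      abs_of_nonneg (by positivity : (0 : ℤ) ≤ 2 ^ k)] at h1
    have hlast : a (Fin.last k) = 0 :=
      Int.abs_lt_one_iff.1 (lt_of_mul_lt_mul_right (h1.trans_eq (one_mul _).symm) (by positivity))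
    rw [hlast, zero_mul, add_zero] at h
    have h2 := ih (fun j => a j.castSucc) (fun j => ha _) h
    ext j
    refine Fin.lastCases hlast (fun i => ?_) j
    exact congrFun h2 i

theorem sum_smul_append {G : Type u} [AddCommGroup G] {m k : ℕ} (u : Fin m → G) (v : Fin k → G)
    (a : Fin (m + k) → ℤ) (I : Finset (Fin (m + k))) :
    ∑ i ∈ I, a i • Fin.append u v i =
      ∑ i with Fin.castAdd k i ∈ I, a (Fin.castAdd k i) • u i +
        ∑ j with Fin.natAdd m j ∈ I, a (Fin.natAdd m j) • v j := by
  rw [← Finset.filter_univ_mem I, Finset.sum_filter, Fin.sum_univ_add, Finset.sum_filter,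
    Finset.sum_filter]
  simp

/-- A subgroup generated by a set `S` contains a sequence without nonempty signed zero-sum
subsequences whose length is at least the binary logarithm of the order, up to `S.card`. -/
theorem exists_forall_not_isWeightedZeroSum {G : Type u} [AddCommGroup G] [Finite G]
    (S : Finset G) :
    ∃ (d : ℕ) (c : Fin d → G), (∀ i, c i ∈ AddSubgroup.closure (S : Set G)) ∧
      (∀ I : Finset (Fin d), I.Nonempty → ¬ IsWeightedZeroSum {1, -1} c I) ∧
      Nat.card (AddSubgroup.closure (S : Set G)) ≤ 2 ^ (d + S.card) := by
  classical
  induction S using Finset.induction_on with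
  | empty =>
    refine ⟨0, Fin.elim0, fun i => i.elim0, fun I ⟨i, _⟩ => i.elim0, by simp⟩
  | insert g S hgS ih =>
    obtain ⟨d, c, hcS, hc, hcard⟩ := ih
    rw [Finset.coe_insert, Finset.card_insert_of_notMem hgS]
    set H := AddSubgroup.closure (S : Set G) with hH
    have hHle : H ≤ AddSubgroup.closure (insert g (S : Set G)) :=
      AddSubgroup.closure_mono (Set.subset_insert _ _)
    have hg : g ∈ AddSubgroup.closure (insert g (S : Set G)) :=
      AddSubgroup.subset_closure (Set.mem_insert _ _)
    -- The least such `m` is the order of `g` modulo `H`.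
    have hex : ∃ m, 0 < m ∧ m • g ∈ H :=
      ⟨addOrderOf g, addOrderOf_pos g, by rw [addOrderOf_nsmul_eq_zero]; exact H.zero_mem⟩
    obtain ⟨hm, hmg⟩ := Nat.find_spec hex
    have hmin := fun k => Nat.find_min (m := k) hex
    generalize Nat.find hex = m at hm hmg hmin
    -- A signed sum of the new terms has coefficient below `2 ^ Nat.log 2 m ≤ m` in absolute value,
    -- so it lies in `H` only if that coefficient vanishes, which forces no new term to be used.
    -- Rounding the logarithm down costs at most one bit per generator.
    refine ⟨d + Nat.log 2 m, Fin.append c fun j => 2 ^ (j : ℕ) • g, ?_, ?_, ?_⟩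
    · intro i
      refine Fin.addCases (fun i => ?_) (fun j => ?_) i
      · rw [Fin.append_left]; exact hHle (hcS i)
      · rw [Fin.append_right]; exact AddSubgroup.nsmul_mem _ hg _
    · rintro I ⟨i₀, hi₀⟩ ⟨a, ha, ha0⟩
      rw [sum_smul_append] at ha0
      let b : Fin (Nat.log 2 m) → ℤ := fun j => if Fin.natAdd d j ∈ I then a (Fin.natAdd d j) else 0
      have hb : ∀ j, |b j| ≤ 1 := by
        intro j
        by_cases hj : Fin.natAdd d j ∈ I
        · obtain h | h : _ = (1 : ℤ) ∨ _ = (-1 : ℤ) := ha _ hj <;> simp [b, hj, h]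
        · simp [b, hj]
      have hbsum : ∑ j with Fin.natAdd d j ∈ I, a (Fin.natAdd d j) • (2 ^ (j : ℕ) • g) =
          (∑ j, b j * 2 ^ (j : ℕ)) • g := by
        rw [Finset.sum_smul, Finset.sum_filter]
        refine Finset.sum_congr rfl fun j _ => ?_
        by_cases hj : Fin.natAdd d j ∈ I
        · simp only [b, hj, if_true, mul_smul]
          rw [← natCast_zsmul g]
          push_cast
          rfl
        · simp [b, hj]
      rw [hbsum] at ha0
      have hbH : (∑ j, b j * 2 ^ (j : ℕ)) • g ∈ H := by
        rw [eq_neg_of_add_eq_zero_right ha0]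
        exact H.neg_mem (H.sum_mem fun i _ => H.zsmul_mem (hcS i) _)
      have hlt := abs_sum_mul_two_pow_lt b hb
      have hb0 : ∑ j, b j * 2 ^ (j : ℕ) = 0 := by
        by_contra hne
        refine hmin (∑ j, b j * 2 ^ (j : ℕ)).natAbs ?_ ⟨Int.natAbs_pos.2 hne, ?_⟩
        · have : (2 : ℤ) ^ Nat.log 2 m ≤ m := by exact_mod_cast Nat.pow_log_le_self 2 hm.ne'
          rw [← Int.ofNat_lt, Int.natCast_natAbs]
          exact hlt.trans_le this
        · rw [← natCast_zsmul]
          rcases Int.natAbs_eq (∑ j, b j * 2 ^ (j : ℕ)) with h | h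
          · rwa [← h]
          · rw [← neg_eq_iff_eq_neg.2 h, neg_smul]
            exact H.neg_mem hbH
      have hb00 := eq_zero_of_sum_mul_two_pow_eq_zero b hb hb0
      have hno : ∀ j, Fin.natAdd d j ∉ I := by
        intro j hj
        have := congrFun hb00 j
        obtain h | h : _ = (1 : ℤ) ∨ _ = (-1 : ℤ) := ha _ hj <;> simp [b, hj, h] at this
      rw [hb0, zero_smul, add_zero] at ha0
      refine hc (Finset.univ.filter fun i => Fin.castAdd _ i ∈ I) ?_
        ⟨fun i => a (Fin.castAdd _ i), fun i hi => ha _ (Finset.mem_filter.1 hi).2, ha0⟩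
      revert hi₀
      refine Fin.addCases (fun i hi => ⟨i, by simpa using hi⟩) (fun j hj => (hno j hj).elim) i₀
    · have hsurj : Function.Surjective (fun x : Fin m × H =>
          (⟨(x.1 : ℕ) • g + x.2, AddSubgroup.add_mem _ (AddSubgroup.nsmul_mem _ hg _)
            (hHle x.2.2)⟩ : AddSubgroup.closure (insert g (S : Set G)))) := by
        rintro ⟨x, hx⟩
        rw [Set.insert_eq, AddSubgroup.closure_union, AddSubgroup.mem_sup] at hx
        obtain ⟨y, hy, z, hz, rfl⟩ := hx
        obtain ⟨n, rfl⟩ := AddSubgroup.mem_closure_singleton.1 hy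
        have hm' : (0 : ℤ) < m := by exact_mod_cast hm
        have h0 := Int.emod_nonneg n hm'.ne'
        have h1 := Int.emod_lt_of_pos n hm'
        refine ⟨(⟨(n % m).toNat, by omega⟩, ⟨(n / m) • (m • g) + z,
          H.add_mem (H.zsmul_mem hmg _) hz⟩), Subtype.ext ?_⟩
        simp only
        rw [← add_assoc, ← natCast_zsmul, ← natCast_zsmul, Int.toNat_of_nonneg h0, ← mul_smul,
          ← add_smul, mul_comm, Int.emod_add_mul_ediv]
      have h1 := Nat.card_le_card_of_surjective _ hsurj
      rw [Nat.card_prod, Nat.card_fin] at h1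
      calc _ ≤ m * Nat.card H := h1
        _ ≤ 2 ^ (Nat.log 2 m + 1) * 2 ^ (d + S.card) :=
          Nat.mul_le_mul (Nat.lt_pow_succ_log_self one_lt_two m).le hcard
        _ = _ := by rw [← pow_add]; congr 1; ring

/-- With `exp(G) - 1` zeros prepended, a subsequence of length `exp(G)` must use a term of `c`; the
zeros do not affect the sum. -/
theorem exponent_add_le_weightedEGZ {G : Type u} [AddCommGroup G] [Finite G] {d : ℕ}
    (c : Fin d → G)
    (hc : ∀ I : Finset (Fin d), I.Nonempty → ¬ IsWeightedZeroSum {1, -1} c I) :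
    AddMonoid.exponent G + d ≤ weightedEGZ {1, -1} G := by
  classical
  have hpos : 0 < AddMonoid.exponent G :=
    Nat.pos_of_ne_zero AddMonoid.ExponentExists.of_finite.exponent_ne_zero
  have hmem : weightedEGZ {1, -1} G ∈ weightedEGZSet {1, -1} G :=
    Nat.sInf_mem (weightedEGZSet_nonempty {1, -1} (by simp) G)
  by_contra! hlt
  obtain ⟨I, hI, a, ha, ha0⟩ := hmem (AddMonoid.exponent G - 1 + d) (by omega)
    (Fin.append (fun _ => 0) c)
  rw [sum_smul_append] at ha0
  simp only [smul_zero, Finset.sum_const_zero, zero_add] at ha0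
  refine hc _ ?_ ⟨fun j => a (Fin.natAdd _ j), fun j hj => ha _ (Finset.mem_filter.1 hj).2, ha0⟩
  by_contra hemp
  rw [Finset.not_nonempty_iff_eq_empty, Finset.filter_eq_empty_iff] at hemp
  have hsub : I ⊆ Finset.univ.image (Fin.castAdd d) := by
    intro i
    refine Fin.addCases (fun i _ => by simp) (fun j hj => (hemp (Finset.mem_univ j) hj).elim) i
  have := (Finset.card_le_card hsub).trans Finset.card_image_le
  rw [Finset.card_univ, Fintype.card_fin] at this
  omega

theorem exponent_add_logb_card_sub_rank_le_weightedEGZ (G : Type u) [AddCommGroup G] [Finite G] :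
    (AddMonoid.exponent G : ℝ) + Real.logb 2 (Nat.card G) - AddGroup.rank G ≤
      weightedEGZ {1, -1} G := by
  obtain ⟨S, hS, hSG⟩ := AddGroup.rank_spec G
  obtain ⟨d, c, -, hc, hcard⟩ := exists_forall_not_isWeightedZeroSum S
  rw [hSG, AddSubgroup.card_top, hS] at hcard
  have h1 : ((AddMonoid.exponent G + d : ℕ) : ℝ) ≤ weightedEGZ {1, -1} G :=
    Nat.cast_le.2 (exponent_add_le_weightedEGZ c hc)
  have h2 : Real.logb 2 (Nat.card G) ≤ (d + AddGroup.rank G : ℕ) := by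
    rw [Real.logb_le_iff_le_rpow one_lt_two (by exact_mod_cast Nat.card_pos), Real.rpow_natCast]
    exact_mod_cast hcard
  push_cast at h1 h2
  linarith

/-! ### Choice of parameters and uniform constants -/

theorem weightedEGZ_le_card_mul_exponent_sub_one_add_one {A : Set ℤ} (hA : 1 ∈ A) (G : Type u)
    [AddCommGroup G] [Finite G] :
    weightedEGZ A G ≤ Nat.card G * (AddMonoid.exponent G - 1) + 1 := by
  classical
  have := Fintype.ofFinite G
  refine Nat.sInf_le fun l hl c => ?_
  obtain ⟨g, -, hg⟩ := Finset.exists_lt_card_fiber_of_mul_lt_card_of_maps_to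
    (s := (Finset.univ : Finset (Fin l))) (t := (Finset.univ : Finset G)) (f := c)
    (n := AddMonoid.exponent G - 1) (fun _ _ => Finset.mem_univ _)
    (by rw [Finset.card_univ, Finset.card_univ, Fintype.card_fin, ← Nat.card_eq_fintype_card]
        omega)
  obtain ⟨I, hI, hcard⟩ := Finset.exists_subset_card_eq (n := AddMonoid.exponent G)
    (Nat.le_of_pred_lt hg)
  refine ⟨I, hcard, fun _ => 1, fun _ _ => hA, ?_⟩
  have h : ∀ i ∈ I, (1 : ℤ) • c i = g := fun i hi => by
    simpa using (Finset.mem_filter.1 (hI hi)).2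
  rw [Finset.sum_congr rfl h, Finset.sum_const, hcard, AddMonoid.exponent_nsmul_eq_zero]

/-- With `x = log₂ g` and `y = log₂ x`, the choice is `L = ⌊x + (2K + 2)y⌋` and `H = n / 2`. Since
`g ≤ n ^ r`, `L` is `O(log n)` and `B * g` is below `H ^ (r + 1)` for large `n`. -/
theorem exists_length_bound (r K B : ℕ) :
    ∃ N : ℕ, ∀ n g : ℕ, N ≤ n → Even n → n ≤ g → g ≤ n ^ r → ∃ L H : ℕ,
      (L : ℝ) ≤ Real.logb 2 g + (2 * K + 2) * Real.logb 2 (Real.logb 2 g) ∧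
      2 * g * (L + 1) ^ K < 2 ^ L ∧ 2 * (1 + (r + 1) * K) ≤ H ∧ B * g < H ^ (r + 1) ∧
      H + (r + 1) * L * (2 * K) + K * (2 * (1 + (r + 1) * K)) ≤ n := by
  -- From `L ≤ (4K + 5)x` and `x ≤ 2r log n`, the reservoir term is at most `a * log n`.
  set a : ℝ := (r + 1) * (2 * K) * ((4 * K + 5) * (2 * r)) with ha
  set b : ℕ := K * (2 * (1 + (r + 1) * K)) with hb
  have ha0 : 0 ≤ a := by positivity
  have hlog : ∀ᶠ n : ℕ in Filter.atTop, Real.log n ≤ 1 / (4 * (a + 1)) * n := by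
    have h := (Real.isLittleO_log_id_atTop.def (c := 1 / (4 * (a + 1)))
      (by positivity)).natCast_atTop
    filter_upwards [h] with n hn
    have := (le_abs_self _).trans hn
    simpa using this
  obtain ⟨N, hN⟩ := Filter.eventually_atTop.1 hlog
  obtain ⟨P, hP⟩ : ∃ P, 2 ^ (4 * K + 6) = P := ⟨_, rfl⟩
  refine ⟨N + P + 4 * b + 4 * (1 + (r + 1) * K) + 2 * (B * 2 ^ r + 1),
    fun n g hn he hng hgn => ?_⟩
  have hlogn := hN n (by omega)
  have hn2 : 2 ^ (4 * K + 6) ≤ n := by rw [hP]; omega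
  have hn1 : 1 ≤ n := Nat.one_le_two_pow.trans hn2
  have hg0 : (0 : ℝ) < g := by exact_mod_cast hn1.trans hng
  have hx : (4 * K + 6 : ℝ) ≤ Real.logb 2 g := by
    rw [Real.le_logb_iff_rpow_le one_lt_two hg0]
    have : ((2 ^ (4 * K + 6) : ℕ) : ℝ) ≤ g := by exact_mod_cast hn2.trans hng
    refine le_trans (le_of_eq ?_) this
    push_cast
    rw [← Real.rpow_natCast]
    push_cast
    rfl
  have hlog2 : (1 / 2 : ℝ) ≤ Real.log 2 := by linarith [Real.log_two_gt_d9]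
  have hlogb : ∀ t : ℝ, 1 ≤ t → Real.logb 2 t ≤ 2 * Real.log t := by
    intro t ht
    rw [Real.logb, div_le_iff₀ (by linarith)]
    nlinarith [Real.log_nonneg ht]
  have hgx : (g : ℝ) = 2 ^ Real.logb 2 g :=
    (Real.rpow_logb two_pos (by norm_num) hg0).symm
  have hxn : Real.logb 2 g ≤ 2 * r * Real.log n := by
    have h1 : Real.log g ≤ r * Real.log n := by
      rw [← Real.log_pow]
      exact Real.log_le_log hg0 (by exact_mod_cast hgn)
    linarith [hlogb g (by exact_mod_cast hn1.trans hng)]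
  generalize Real.logb 2 g = x at hx hgx hxn ⊢
  have hK0 : (0 : ℝ) ≤ K := by positivity
  have hx0 : 0 < x := by linarith
  have hy1 : 1 ≤ Real.logb 2 x := by
    rw [Real.le_logb_iff_rpow_le one_lt_two hx0, Real.rpow_one]
    linarith
  have hy2 : Real.logb 2 x ≤ 2 * x :=
    (hlogb x (by linarith)).trans (by linarith [Real.log_le_self hx0.le])
  have hxy : x = 2 ^ Real.logb 2 x := (Real.rpow_logb two_pos (by norm_num) hx0).symm
  generalize Real.logb 2 x = y at hy1 hy2 hxy ⊢
  have hz0 : 0 ≤ x + (2 * K + 2) * y := by positivity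
  have hL1 := Nat.floor_le hz0
  have hL2 := Nat.lt_floor_add_one (x + (2 * K + 2) * y)
  generalize ⌊x + (2 * K + 2) * y⌋₊ = L at hL1 hL2
  have hLx : (L : ℝ) ≤ (4 * K + 5) * x := by nlinarith
  refine ⟨L, n / 2, hL1, ?_, by omega, ?_, ?_⟩
  -- Here `x ≥ 4K + 6` is used. Then `(L + 1) ^ K ≤ 2 ^ (2Ky)`, and `L > x + (2K + 2)y - 1 ≥ 1 + x +
  -- 2Ky` because `y ≥ 1`.
  · have h1 : (L + 1 : ℝ) ≤ x ^ 2 := by nlinarith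
    have h2 : (2 * g * (L + 1) ^ K : ℝ) ≤ 2 ^ (1 + x + 2 * K * y) := by
      calc (2 * g * (L + 1) ^ K : ℝ) ≤ 2 * g * (x ^ 2) ^ K := by gcongr
        _ = 2 ^ (1 : ℝ) * 2 ^ x * 2 ^ (2 * K * y) := by
          rw [Real.rpow_one, hgx, ← pow_mul]
          congr 1
          rw [mul_comm (2 * (K : ℝ)) y, Real.rpow_mul two_pos.le, ← hxy, ← Real.rpow_natCast]
          push_cast
          rfl
        _ = _ := by rw [← Real.rpow_add two_pos, ← Real.rpow_add two_pos]
    have h3 : (2 : ℝ) ^ (1 + x + 2 * K * y) < 2 ^ L := by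
      rw [← Real.rpow_natCast]
      exact Real.rpow_lt_rpow_of_exponent_lt one_lt_two (by linarith)
    exact_mod_cast h2.trans_lt h3
  · obtain ⟨h, rfl⟩ := he
    rw [← two_mul, Nat.mul_div_cancel_left _ two_pos]
    calc B * g ≤ B * (h + h) ^ r := Nat.mul_le_mul_left _ hgn
      _ = B * 2 ^ r * h ^ r := by rw [← two_mul, mul_pow, mul_assoc]
      _ < h * h ^ r := Nat.mul_lt_mul_of_pos_right (by omega) (pow_pos (by omega) r)
      _ = h ^ (r + 1) := (pow_succ' h r).symm
  · have h1 : ((r + 1) * L * (2 * K) : ℝ) ≤ n / 4 := by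
      calc ((r + 1) * L * (2 * K) : ℝ) ≤ (r + 1) * ((4 * K + 5) * (2 * r * Real.log n)) *
            (2 * K) := by
              gcongr
              exact hLx.trans (by gcongr)
        _ = a * Real.log n := by rw [ha]; ring
        _ ≤ a * (1 / (4 * (a + 1)) * n) := by gcongr
        _ = (a / (a + 1)) * (n / 4) := by field_simp
        _ ≤ 1 * (n / 4) := by
          gcongr
          rw [div_le_one (by positivity)]
          linarith
        _ = n / 4 := one_mul _
    have h2 : 4 * ((r + 1) * L * (2 * K)) ≤ n := by
      have : (4 * ((r + 1) * L * (2 * K)) : ℝ) ≤ n := by linarith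
      exact_mod_cast this
    omega

/-- The upper bound for groups of large exponent, with constants depending on the rank. -/
theorem exists_forall_weightedEGZ_le (r : ℕ) :
    ∃ K N : ℕ, ∀ (G : Type u) [AddCommGroup G] [Finite G],
      AddGroup.rank G = r → Even (AddMonoid.exponent G) → N ≤ AddMonoid.exponent G →
        (weightedEGZ {1, -1} G : ℝ) ≤ AddMonoid.exponent G + Real.logb 2 (Nat.card G) +
          (2 * K + 2) * Real.logb 2 (Real.logb 2 (Nat.card G)) := by
  obtain ⟨Q, hQsub, hQ⟩ := (Nat.infinite_setOfPred_prime.sdiff (Set.finite_singleton 2)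
    ).exists_subset_card_eq (r + 1)
  have hQp : ∀ p ∈ Q, p.Prime ∧ p ≠ 2 ∧ p ≤ Q.sup id := fun p hp =>
    ⟨(hQsub hp).1, fun h => (hQsub hp).2 h, Finset.le_sup (f := id) hp⟩
  generalize Q.sup id = K at hQp
  obtain ⟨N, hN⟩ := exists_length_bound r K
    ((2 ^ (1 + (r + 1) * K) * (1 + (r + 1) * K).factorial) ^ 2)
  refine ⟨K, N, fun G _ _ hr he hNG => ?_⟩
  obtain ⟨L, H, hLle, hL, hH, hHG, hn⟩ := hN _ (Nat.card G) hNG he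
    (Nat.le_of_dvd Nat.card_pos AddGroup.exponent_dvd_nat_card)
    (hr ▸ Nat.le_of_dvd (pow_pos (Nat.pos_of_ne_zero
      AddMonoid.ExponentExists.of_finite.exponent_ne_zero) _)
      (card_dvd_exponent_nsmul_rank G))
  have h : weightedEGZ {1, -1} G ≤ AddMonoid.exponent G + L := Nat.sInf_le fun l hl c =>
    exists_isWeightedZeroSum_card_eq Q hQ hQp hH hHG hL he hn c hl
  have h' : (weightedEGZ {1, -1} G : ℝ) ≤ AddMonoid.exponent G + L := by exact_mod_cast h
  linarith

theorem one_le_logb_logb_of_four_le {x : ℝ} (h : 4 ≤ x) : 1 ≤ Real.logb 2 (Real.logb 2 x) := by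
  have h1 : 2 ≤ Real.logb 2 x := by
    rw [Real.le_logb_iff_rpow_le one_lt_two (by linarith)]
    norm_num
    exact h
  rw [Real.le_logb_iff_rpow_le one_lt_two (by linarith)]
  norm_num
  exact h1

/-- The upper bound for all groups of even exponent. -/
theorem exists_nonneg_forall_weightedEGZ_le (r : ℕ) :
    ∃ C : ℝ, 0 ≤ C ∧ ∀ (G : Type u) [AddCommGroup G] [Finite G],
      AddGroup.rank G = r → Even (AddMonoid.exponent G) →
        (weightedEGZ {1, -1} G : ℝ) ≤ AddMonoid.exponent G + Real.logb 2 (Nat.card G) +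
          C * Real.logb 2 (Real.logb 2 (Nat.card G)) := by
  obtain ⟨K, N, hN⟩ := exists_forall_weightedEGZ_le.{u} r
  -- The extra `N ^ (r + 1)` absorbs the pigeonhole bound for groups of exponent below `N`.
  refine ⟨(2 * K + 2) + (N : ℝ) ^ (r + 1), by positivity, fun G _ _ hr he => ?_⟩
  have hn0 : 0 < AddMonoid.exponent G :=
    Nat.pos_of_ne_zero AddMonoid.ExponentExists.of_finite.exponent_ne_zero
  have hdvd : AddMonoid.exponent G ∣ Nat.card G := AddGroup.exponent_dvd_nat_card
  have hcard : Nat.card G ≤ AddMonoid.exponent G ^ r :=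
    hr ▸ Nat.le_of_dvd (pow_pos hn0 _) (card_dvd_exponent_nsmul_rank G)
  have hs := weightedEGZ_le_card_mul_exponent_sub_one_add_one (A := {1, -1}) (by simp) G
  have hg2 : 2 ∣ Nat.card G := he.two_dvd.trans hdvd
  have hg0 : 0 < Nat.card G := Nat.card_pos
  -- For `|G| = 2` the iterated logarithm is 0 and absorbs nothing, but the pigeonhole bound `2 * 1
  -- + 1` is exactly `exp(G) + log₂|G|`. Otherwise `|G| ≥ 4` and the iterated logarithm is at least
  -- 1.
  by_cases hg : Nat.card G = 2
  · have hn : AddMonoid.exponent G = 2 := by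
      have h1 := Nat.le_of_dvd hg0 hdvd
      have h2 := Nat.le_of_dvd hn0 he.two_dvd
      omega
    rw [hg, hn] at hs ⊢
    norm_num
    exact hs
  · have hg4 : (4 : ℝ) ≤ Nat.card G := by
      have : 4 ≤ Nat.card G := by omega
      exact_mod_cast this
    have hll := one_le_logb_logb_of_four_le hg4
    have hl : 0 ≤ Real.logb 2 (Nat.card G) := Real.logb_nonneg one_lt_two (by linarith)
    rcases le_or_gt N (AddMonoid.exponent G) with hNG | hNG
    · have := hN G hr he hNG
      have h0 : 0 ≤ (N : ℝ) ^ (r + 1) * Real.logb 2 (Real.logb 2 (Nat.card G)) := by positivity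
      linarith
    · have h1 : weightedEGZ {1, -1} G ≤ N ^ (r + 1) := by
        calc weightedEGZ {1, -1} G ≤ Nat.card G * (AddMonoid.exponent G - 1) + 1 := hs
          _ ≤ Nat.card G * (AddMonoid.exponent G - 1) + Nat.card G := by omega
          _ = Nat.card G * AddMonoid.exponent G := by
            rw [← Nat.mul_add_one, Nat.sub_add_cancel hn0]
          _ ≤ AddMonoid.exponent G ^ r * AddMonoid.exponent G := Nat.mul_le_mul_right _ hcard
          _ = AddMonoid.exponent G ^ (r + 1) := (pow_succ _ _).symm
          _ ≤ N ^ (r + 1) := Nat.pow_le_pow_left hNG.le _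
      have h2 : (weightedEGZ {1, -1} G : ℝ) ≤ (N : ℝ) ^ (r + 1) := by exact_mod_cast h1
      have h3 : (N : ℝ) ^ (r + 1) * 1 ≤
          (N : ℝ) ^ (r + 1) * Real.logb 2 (Real.logb 2 (Nat.card G)) := by gcongr
      have h4 : 0 ≤ (2 * K + 2) * Real.logb 2 (Real.logb 2 (Nat.card G)) := by positivity
      have h5 : (0 : ℝ) ≤ AddMonoid.exponent G := by positivity
      linarith

theorem theorem1p2 (r : ℕ) (hr : 1 ≤ r) :
    (∃ C : ℝ, ∀ (G : Type u) [AddCommGroup G] [Finite G],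
      AddGroup.rank G = r → Even (AddMonoid.exponent G) →
        (weightedEGZ {1, -1} G : ℝ) ≤
          (AddMonoid.exponent G : ℝ) + Real.logb 2 (Nat.card G : ℝ) +
            C * Real.logb 2 (Real.logb 2 (Nat.card G : ℝ))) ∧
    (∃ C : ℝ, 0 < C ∧ ∃ N : ℕ, ∀ (G : Type u) [AddCommGroup G] [Finite G],
      AddGroup.rank G = r → Even (AddMonoid.exponent G) → N ≤ AddMonoid.exponent G →
        |(weightedEGZ {1, -1} G : ℝ) -
            ((AddMonoid.exponent G : ℝ) + Real.logb 2 (Nat.card G : ℝ))| ≤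
          C * |Real.logb 2 (Real.logb 2 (Nat.card G : ℝ))|) := by
  obtain ⟨C, hC0, hC⟩ := exists_nonneg_forall_weightedEGZ_le.{u} r
  have hr' : (1 : ℝ) ≤ r := by exact_mod_cast hr
  -- The lower bound loses the rank `r`, at most `r` times the iterated logarithm once `exp(G) ≥ 4`.
  refine ⟨⟨C, fun G _ _ => hC G⟩, C + r, by linarith, 4, fun G _ _ hrG he hG => ?_⟩
  have hcard : AddMonoid.exponent G ≤ Nat.card G :=
    Nat.le_of_dvd Nat.card_pos AddGroup.exponent_dvd_nat_card
  have hll := one_le_logb_logb_of_four_le (x := Nat.card G) (by exact_mod_cast hG.trans hcard)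
  have hup := hC G hrG he
  have hlow := exponent_add_logb_card_sub_rank_le_weightedEGZ G
  rw [hrG] at hlow
  rw [abs_of_nonneg (zero_le_one.trans hll), abs_le]
  constructor <;> nlinarith
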